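/- For a set $S\subseteq[N]=\{1,\dots,N\}$, the Schubert matroid $\mathrm{SM}_N(S)$ is the matroid on $[N]$ whose bases are the sets $T\subseteq[N]$ with $|T|=|S|$ such that, for every $i$, the $i$-th smallest element of $T$ does not exceed the $i$-th smallest element of $S$. For a matroid $M$ on $[N]$ let $\mathcal P(M)\subset\mathbb R^N$ be the convex hull of the indicator vectors of its bases, and let $i(M,t)=|t\,\mathcal P(M)\cap\mathbb Z^N|$ for integers $t\ge 0$ (the Ehrhart polynomial of $\mathcal P(M)$ evaluated at $t$). For integers $a,b,n\ge1$ the $(a,b)$-Catalan matroid $\mathbf C_n^{a,b}$ is $\mathrm{SM}_{n(a+b)}(S)$, where $S$ is the set with indicator vector $(0^a,1^b,0^a,1^b,\dots,0^a,1^b)$ ($n$ blocks $0^a,1^b$). For integers $a,b,t\ge0$ and $c\in\mathbb Z$ put $$F(a,b,c,t)=\sum_{j=0}^{a+b}(-1)^j\binom{a+b}{j}\binom{(t+1)(b-j)+a+c-1}{a+b-1},$$ where $\binom{p}{k}=0$ if $k<0$ or $p<k$. For a composition $\sigma=(\sigma_1,\dots,\sigma_s)$ of $n$ (so $\sigma_1+\dots+\sigma_s=n$)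 let $\ell(\sigma)=s$. Two compositions are equivalent if one is obtained from the other by a cyclic shift of its parts; $d(\sigma)$ is the number of compositions in the equivalence class of $\sigma$. Let $\Gamma_n$ be a transversal (one representative from each class) of the equivalence classes of those compositions of $n$ that have at least two parts and all of whose parts are larger than $1$. **Theorem.** Let $a,b\ge1$ and $n\ge2$ be integers, and let $\Gamma_n$ be any such transversal. Then, for every integer $t\ge0$, $$i(\mathbf C_n^{a,b},t)=\frac1n F(na,nb,0,t)-\frac1n F(a,b,0,t)^n+F(a,b,0,t)\, i(\mathbf C_{n-1}^{a,b},t)+\sum_{\sigma\in\Gamma_n}(-1)^{\ell(\sigma)}\frac{d(\sigma)}{\ell(\sigma)}\, i(\overline{\mathbf C}_\sigma^{a,b},t),$$ where $$i(\overline{\mathbf C}_\sigma^{a,b},t)=\prod_{j=1}^{\ell(\sigma)} i(\overline{\mathbf C}_{\sigma_j}^{a,b},t),\qquad i(\overline{\mathbf C}_{m}^{a,b},t)=i(\mathbf C_{m}^{a,b},t)-F(a,b,0,t)\, i(\mathbf C_{m-1}^{a,b},t)\quad(m\ge2),$$ and $i(\mathbf C_1^{a,b},t)=F(a,b,0,t)$.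 -/

import Mathlib

open scoped Pointwise

/-- `T ≤ S` for finite sets: `|T| = |S|`, and the `i`-th smallest element of `T` does not exceed
the `i`-th smallest element of `S`, for every `i`. -/
def SchubertLE {N : ℕ} (T S : Finset (Fin N)) : Prop :=
  ∃ h : T.card = S.card, ∀ i : Fin S.card, T.orderEmbOfFin h i ≤ S.orderEmbOfFin rfl i

theorem card_filter_le_eq {N k : ℕ} (T : Finset (Fin N)) (h : T.card = k) (x : Fin N) :
    (T.filter (· ≤ x)).card
      = ((Finset.univ : Finset (Fin k)).filter (fun i => T.orderEmbOfFin h i ≤ x)).card := by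
  conv_lhs => rw [← Finset.map_orderEmbOfFin_univ T h]
  rw [Finset.filter_map, Finset.card_map]
  rfl

theorem schubertLE_iff {N : ℕ} (T S : Finset (Fin N)) :
    SchubertLE T S ↔ T.card = S.card ∧
      ∀ x : Fin N, (S.filter (· ≤ x)).card ≤ (T.filter (· ≤ x)).card := by
  constructor
  · rintro ⟨h, hle⟩
    refine ⟨h, fun x => ?_⟩
    rw [card_filter_le_eq S rfl, card_filter_le_eq T h]
    refine Finset.card_le_card fun i hi => ?_
    simp only [Finset.mem_filter, Finset.mem_univ, true_and] at hi ⊢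
    exact (hle i).trans hi
  · rintro ⟨h, hc⟩
    refine ⟨h, fun i => ?_⟩
    by_contra hlt
    have h1 := hc (S.orderEmbOfFin rfl i)
    rw [card_filter_le_eq S rfl, card_filter_le_eq T h] at h1
    have h2 : (Finset.Iic i).card ≤ ((Finset.univ : Finset (Fin S.card)).filter
        (fun j => S.orderEmbOfFin rfl j ≤ S.orderEmbOfFin rfl i)).card := by
      refine Finset.card_le_card fun j hj => ?_
      simpa using hj
    have h3 : ((Finset.univ : Finset (Fin S.card)).filter
        (fun j => T.orderEmbOfFin h j ≤ S.orderEmbOfFin rfl i)).card ≤ (Finset.Iio i).card := by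
      refine Finset.card_le_card fun j hj => ?_
      simp only [Finset.mem_filter, Finset.mem_univ, true_and] at hj
      rw [Finset.mem_Iio]
      exact (T.orderEmbOfFin h).lt_iff_lt.1 (lt_of_le_of_lt hj (not_le.1 hlt))
    rw [Fin.card_Iic] at h2
    rw [Fin.card_Iio] at h3
    omega

theorem schubertLE_exchange {N : ℕ} (S : Finset (Fin N)) :
    Matroid.ExchangeProperty
      (fun B : Set (Fin N) => ∃ T : Finset (Fin N), (T : Set (Fin N)) = B ∧ SchubertLE T S) := by
  rintro _ _ ⟨X, rfl, hX⟩ ⟨Y, rfl, hY⟩ a ha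
  rw [schubertLE_iff] at hX hY
  obtain ⟨hXc, hX⟩ := hX
  obtain ⟨hYc, hY⟩ := hY
  have haX : a ∈ X := ha.1
  have haY : a ∉ Y := ha.2
  have hne : (Y \ X).Nonempty := by
    rw [Finset.sdiff_nonempty]
    intro hsub
    exact haY (Finset.eq_of_subset_of_card_le hsub (by omega) ▸ haX)
  have hb := Finset.min'_mem _ hne
  set b := (Y \ X).min' hne with hbdef
  rw [Finset.mem_sdiff] at hb
  have hba : b ∉ X.erase a := fun h => hb.2 (Finset.mem_of_mem_erase h)
  refine ⟨b, ⟨hb.1, hb.2⟩, insert b (X.erase a), by simp, ?_⟩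
  rw [schubertLE_iff]
  have hpos := Finset.card_pos.2 ⟨a, haX⟩
  refine ⟨by rw [Finset.card_insert_of_notMem hba, Finset.card_erase_of_mem haX]; omega,
    fun x => ?_⟩
  have hXx := hX x
  have hYx := hY x
  have hbax : b ∉ (X.filter (· ≤ x)).erase a :=
    fun h => hb.2 (Finset.mem_filter.1 (Finset.mem_of_mem_erase h)).1
  by_cases hbx : b ≤ x
  · have e : (insert b (X.erase a)).filter (· ≤ x) = insert b ((X.filter (· ≤ x)).erase a) := by
      rw [Finset.filter_insert, if_pos hbx, Finset.filter_erase]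
    rw [e, Finset.card_insert_of_notMem hbax]
    have := Finset.pred_card_le_card_erase (s := X.filter (· ≤ x)) (a := a)
    omega
  · have e : (insert b (X.erase a)).filter (· ≤ x) = (X.filter (· ≤ x)).erase a := by
      rw [Finset.filter_insert, if_neg hbx, Finset.filter_erase]
    rw [e]
    by_cases hax : a ≤ x
    · have hmem : a ∈ X.filter (· ≤ x) := Finset.mem_filter.2 ⟨haX, hax⟩
      have hss : Y.filter (· ≤ x) ⊆ (X.filter (· ≤ x)).erase a := by
        intro y hy
        rw [Finset.mem_filter] at hy
        have hyX : y ∈ X := by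
          by_contra hyX
          exact hbx ((Finset.min'_le _ y (Finset.mem_sdiff.2 ⟨hy.1, hyX⟩)).trans hy.2)
        refine Finset.mem_erase.2 ⟨?_, Finset.mem_filter.2 ⟨hyX, hy.2⟩⟩
        rintro rfl
        exact haY hy.1
      exact hYx.trans (Finset.card_le_card hss)
    · have ha' : a ∉ X.filter (· ≤ x) := fun h => hax (Finset.mem_filter.1 h).2
      rw [Finset.erase_eq_of_notMem ha']
      exact hXx

/-- The Schubert matroid of `S`: its ground set is the whole of `Fin N` (playing the role of
`{1, …, N}`), and its bases are the sets `T` with `T ≤ S`. -/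
def schubertMatroid {N : ℕ} (S : Finset (Fin N)) : Matroid (Fin N) :=
  Matroid.ofIsBaseOfFinite (E := Set.univ) Set.finite_univ
    (fun B => ∃ T : Finset (Fin N), (T : Set (Fin N)) = B ∧ SchubertLE T S)
    ⟨S, S, rfl, rfl, fun _ => le_rfl⟩
    (schubertLE_exchange S)
    (fun _ _ => Set.subset_univ _)

/-- The matroid polytope: the convex hull of the indicator vectors of the bases. -/
def matroidPolytope {α : Type*} (M : Matroid α) : Set (α → ℝ) :=
  convexHull ℝ {x | ∃ B : Set α, M.IsBase B ∧ x = B.indicator 1}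

/-- `i(M, t)`, the number of lattice points in the `t`-th dilation of the matroid polytope
of `M`. -/
noncomputable def ehrhart {α : Type*} (M : Matroid α) (t : ℕ) : ℕ :=
  {z : α → ℤ | (fun i => (z i : ℝ)) ∈ (t : ℝ) • matroidPolytope M}.ncard

/-- The subset of a set of `n * (a + b)` elements whose indicator vector is
`(0^a, 1^b, 0^a, 1^b, …, 0^a, 1^b)`, with `n` blocks `0^a, 1^b`; positions are counted
from `0`. -/
def catalanSet (a b n : ℕ) : Finset (Fin (n * (a + b))) :=
  Finset.univ.filter fun i => a ≤ (i : ℕ) % (a + b)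

/-- The `(a, b)`-Catalan matroid. -/
def catalanMatroid (a b n : ℕ) : Matroid (Fin (n * (a + b))) :=
  schubertMatroid (catalanSet a b n)

/-- Binomial coefficient of integers, with the convention that it vanishes when
`k < 0` or `n < k`. -/
def intBinom (n k : ℤ) : ℤ :=
  if 0 ≤ k ∧ k ≤ n then (n.toNat.choose k.toNat : ℤ) else 0

/-- `F(a, b, c, t) = ∑_{j=0}^{a+b} (-1)^j C(a+b, j) C((t+1)(b-j) + a + c - 1, a + b - 1)`. -/
def schubertF (a b : ℕ) (c : ℤ) (t : ℕ) : ℤ :=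
  ∑ j ∈ Finset.range (a + b + 1), (-1) ^ j * intBinom ((a : ℤ) + b) j *
    intBinom (((t : ℤ) + 1) * ((b : ℤ) - j) + a + c - 1) ((a : ℤ) + b - 1)

/-- `i(C̄_m, t) = i(C_m, t) - F(a, b, 0, t) * i(C_{m-1}, t)` (used for `m ≥ 2`). -/
noncomputable def barEhrhart (a b m t : ℕ) : ℤ :=
  (ehrhart (catalanMatroid a b m) t : ℤ)
    - schubertF a b 0 t * (ehrhart (catalanMatroid a b (m - 1)) t : ℤ)

/-- `i(C̄_σ, t)`, the product of `i(C̄_{σ_j}, t)` over the parts `σ_j` of `σ`. -/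
noncomputable def barEhrhartComp (a b : ℕ) {n : ℕ} (σ : Composition n) (t : ℕ) : ℤ :=
  ∏ j : Fin σ.length, barEhrhart a b (σ.blocksFun j) t

/-- Two compositions are equivalent if one is obtained from the other by cyclic shifting
of the parts. -/
def CyclicEquiv {n : ℕ} (σ τ : Composition n) : Prop :=
  σ.blocks ~r τ.blocks

/-- `d(σ)`, the cardinality of the equivalence class of `σ`. -/
noncomputable def cyclicClassCard {n : ℕ} (σ : Composition n) : ℕ :=
  {τ : Composition n | CyclicEquiv σ τ}.ncard

/-- `σ` has at least two parts, and all its parts are larger than `1`. -/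
def IsAdmissible {n : ℕ} (σ : Composition n) : Prop :=
  1 < σ.length ∧ ∀ p ∈ σ.blocks, 1 < p

/-- `Γ` is a transversal of the equivalence classes consisting of compositions of `n` with at
least two parts and with all parts larger than `1`. -/
structure IsCyclicTransversal {n : ℕ} (Γ : Finset (Composition n)) : Prop where
  admissible : ∀ σ ∈ Γ, IsAdmissible σ
  exists_equiv : ∀ σ : Composition n, IsAdmissible σ → ∃ τ ∈ Γ, CyclicEquiv σ τ
  eq_of_equiv : ∀ σ ∈ Γ, ∀ τ ∈ Γ, CyclicEquiv σ τ → σ = τ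

/-!
The integer points of `t` times the polytope of a Schubert matroid are the integer points of
`[0, t] ^ N` whose prefix sums dominate those of `t` times the indicator vector of `S`, with equality
for the full sum (`mem_smul_matroidPolytope_iff`). For the Catalan matroid with `n` blocks it suffices
to test prefix sums at the ends of blocks. Recording the excess of each block sum over `t * b`
therefore turns the Ehrhart polynomial into the number `A n` of excursions: walks of `n` independent
weighted steps which stay nonnegative and end at zero (`ehrhart_catalan`). Dropping the positivity
condition gives bridges, and their number `B n` is `schubertF (n * a) (n * b) 0 t`, a coefficient of
`((1 - X ^ (t + 1)) / (1 - X)) ^ (n * (a + b))` (`bridgeCount_catalanStep`).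

Excursions and bridges are related by `log (∑ A n z ^ n) = ∑ B n z ^ n / n`, stated here as
an identity for the logarithmic derivative (`derivative_excursionCount`). Its source is the
factorization `E (1 - z p) = 1 - D`, where `p` is the Laurent polynomial of the steps in a variable
`u`, `E` counts the walks that stay nonnegative and `D` the walks that exit at their last step: `E`
has only nonnegative powers of `u`, with constant term `∑ A n z ^ n`, and `D` only negative ones, so
`D` disappears on taking logarithmic derivatives and constant terms in `u`.

Writing `F = B 1`, the numbers `barEhrhart` have generating function `(1 - F z) ∑ A n z ^ n`. The
coefficients of its logarithm are `(B n - F ^ n) / n`; on the other hand, expanding the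
logarithm gives an alternating sum over all compositions of `n`
(`logDeriv_coeff_eq_sum_composition`). Compositions with a part `1` contribute nothing because the
coefficient of `z` vanishes, the one with a single part contributes `A n - F A (n - 1)`, and the
others are grouped into cyclic classes (`sum_admissible_eq_sum_transversal`).
-/

/-! ### Lattice points of dilated Schubert matroid polytopes -/

/-- The sum of the first `k` entries of a finite sequence; for `k` at least the length of the
sequence this is the sum of all entries. -/
def prefixSum {M : Type*} [AddCommMonoid M] {N : ℕ} (z : Fin N → M) (k : ℕ) : M :=
  ∑ i : Fin N, if (i : ℕ) < k then z i else 0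

theorem prefixSum_zero {M : Type*} [AddCommMonoid M] {N : ℕ} (z : Fin N → M) :
    prefixSum z 0 = 0 := by
  simp [prefixSum]

theorem prefixSum_of_le {M : Type*} [AddCommMonoid M] {N : ℕ} (z : Fin N → M) {k : ℕ}
    (h : N ≤ k) : prefixSum z k = ∑ i, z i := by
  unfold prefixSum
  refine Finset.sum_congr rfl fun i _ => if_pos (i.2.trans_le h)

theorem prefixSum_succ {M : Type*} [AddCommMonoid M] {N : ℕ} (z : Fin N → M) {k : ℕ}
    (h : k < N) : prefixSum z (k + 1) = prefixSum z k + z ⟨k, h⟩ := by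
  unfold prefixSum
  rw [← (Finset.sum_ite_eq' Finset.univ (⟨k, h⟩ : Fin N) z).trans (if_pos (Finset.mem_univ _)),
    ← Finset.sum_add_distrib]
  refine Finset.sum_congr rfl fun i _ => ?_
  by_cases h1 : i = ⟨k, h⟩
  · subst h1; simp
  · have h2 : (i : ℕ) ≠ k := fun h2 => h1 (Fin.ext h2)
    rw [if_neg h1, add_zero]
    exact if_congr (by omega) rfl rfl

theorem prefixSum_add {M : Type*} [AddCommMonoid M] {N : ℕ} (y z : Fin N → M) (k : ℕ) :
    prefixSum (fun i => y i + z i) k = prefixSum y k + prefixSum z k := by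
  unfold prefixSum
  rw [← Finset.sum_add_distrib]
  refine Finset.sum_congr rfl fun i _ => ?_
  split_ifs <;> simp

theorem prefixSum_mul {R : Type*} [Semiring R] {N : ℕ} (c : R) (z : Fin N → R) (k : ℕ) :
    prefixSum (fun i => c * z i) k = c * prefixSum z k := by
  unfold prefixSum
  rw [Finset.mul_sum]
  refine Finset.sum_congr rfl fun i _ => ?_
  split_ifs <;> simp

theorem map_prefixSum {M M' F : Type*} [AddCommMonoid M] [AddCommMonoid M'] [FunLike F M M']
    [AddMonoidHomClass F M M'] (f : F) {N : ℕ} (z : Fin N → M) (k : ℕ) :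
    f (prefixSum z k) = prefixSum (fun i => f (z i)) k := by
  unfold prefixSum
  rw [map_sum]
  refine Finset.sum_congr rfl fun i _ => ?_
  split_ifs <;> simp

theorem prefixSum_indicator {R : Type*} [Semiring R] {N : ℕ} (T : Finset (Fin N)) (k : ℕ) :
    prefixSum (fun i => if i ∈ T then (1 : R) else 0) k
      = ((T.filter fun i : Fin N => (i : ℕ) < k).card : R) := by
  unfold prefixSum
  rw [Finset.card_eq_sum_ones, Finset.sum_filter, Nat.cast_sum,
    ← Finset.sum_filter_add_sum_filter_not Finset.univ (· ∈ T)]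
  rw [Finset.filter_mem_eq_inter, Finset.univ_inter, Finset.sum_eq_zero (s := Finset.filter _ _),
    add_zero]
  · refine Finset.sum_congr rfl fun i hi => ?_
    simp [hi]
  · intro i hi
    simp [(Finset.mem_filter.1 hi).2]

/-- The order on sets in the definition of a Schubert matroid, in terms of prefix counts. -/
theorem schubertLE_iff_prefix {N : ℕ} (T S : Finset (Fin N)) :
    SchubertLE T S ↔ T.card = S.card ∧ ∀ k : ℕ,
      (S.filter fun i : Fin N => (i : ℕ) < k).card ≤ (T.filter fun i : Fin N => (i : ℕ) < k).card := by
  rw [schubertLE_iff]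
  have hfull : ∀ (R : Finset (Fin N)) (k : ℕ), N ≤ k →
      (R.filter fun i : Fin N => (i : ℕ) < k) = R := fun R k hk =>
    Finset.filter_true_of_mem fun i _ => i.2.trans_le hk
  have hle : ∀ (R : Finset (Fin N)) (x : Fin N),
      (R.filter fun i : Fin N => (i : ℕ) < (x : ℕ) + 1) = R.filter (· ≤ x) := fun R x =>
    Finset.filter_congr fun i _ => by rw [Fin.le_def]; omega
  refine and_congr_right fun hc => ⟨fun h k => ?_, fun h x => ?_⟩
  · rcases le_or_gt N k with hk | hk
    · rw [hfull S k hk, hfull T k hk, hc]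
    · rcases k with _ | k
      · simp
      · have := h ⟨k, by omega⟩
        rwa [← hle, ← hle] at this
  · have := h (x + 1)
    rwa [hle, hle] at this

theorem schubertMatroid_isBase_iff {N : ℕ} (S : Finset (Fin N)) (B : Set (Fin N)) :
    (schubertMatroid S).IsBase B ↔
      ∃ T : Finset (Fin N), (T : Set (Fin N)) = B ∧ SchubertLE T S :=
  Iff.rfl

/-- The inequalities cutting out `t • matroidPolytope (schubertMatroid S)`: all coordinates lie in
`[0, t]`, and the prefix sums dominate those of `t` times the indicator vector of `S`, with
equality for the full sum. -/
structure SchubertIneq {R : Type*} [Ring R] [PartialOrder R] {N : ℕ} (S : Finset (Fin N)) (t : R)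
    (z : Fin N → R) : Prop where
  nonneg : ∀ i, 0 ≤ z i
  le : ∀ i, z i ≤ t
  prefix_le : ∀ k, t * ((S.filter fun i : Fin N => (i : ℕ) < k).card : R) ≤ prefixSum z k
  total : ∑ i, z i = t * (S.card : R)

theorem matroidPolytope_ineq {N : ℕ} (S : Finset (Fin N)) {y : Fin N → ℝ}
    (hy : y ∈ matroidPolytope (schubertMatroid S)) : SchubertIneq S (1 : ℝ) y := by
  have hconv : Convex ℝ {y : Fin N → ℝ | SchubertIneq S (1 : ℝ) y} := by
    intro x hx y hy α β hα hβ hαβ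
    have he : α • x + β • y = fun i => α * x i + β * y i := by ext i; simp
    rw [he]
    refine ⟨fun i => ?_, fun i => ?_, fun k => ?_, ?_⟩
    · have := hx.nonneg i; have := hy.nonneg i; positivity
    · nlinarith [hx.le i, hy.le i]
    · rw [prefixSum_add, prefixSum_mul, prefixSum_mul]
      have hx' := mul_le_mul_of_nonneg_left (hx.prefix_le k) hα
      have hy' := mul_le_mul_of_nonneg_left (hy.prefix_le k) hβ
      calc _ = (α + β) * (1 * ((S.filter fun i : Fin N => (i : ℕ) < k).card : ℝ)) := by rw [hαβ]; ring
        _ ≤ _ := by rw [add_mul]; exact add_le_add hx' hy'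
    · rw [Finset.sum_add_distrib, ← Finset.mul_sum, ← Finset.mul_sum, hx.total, hy.total,
        ← add_mul, hαβ, one_mul]
  refine convexHull_min ?_ hconv hy
  rintro x ⟨B, hB, rfl⟩
  obtain ⟨T, rfl, hT⟩ := (schubertMatroid_isBase_iff S B).1 hB
  obtain ⟨hc, hk⟩ := (schubertLE_iff_prefix T S).1 hT
  have he : (T : Set (Fin N)).indicator (1 : Fin N → ℝ) = fun i => if i ∈ T then (1 : ℝ) else 0 := by
    ext i; simp [Set.indicator_apply]
  rw [he]
  refine ⟨fun i => by split_ifs <;> simp, fun i => by split_ifs <;> simp, fun k => ?_, ?_⟩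
  · rw [prefixSum_indicator, one_mul]
    exact_mod_cast hk k
  · simp [hc]

/-- Hermite's identity for natural number division. -/
theorem sum_range_add_div {t : ℕ} (ht : 0 < t) (Z : ℕ) :
    ∑ j ∈ Finset.range t, (Z + j) / t = Z := by
  induction Z with
  | zero =>
    refine Finset.sum_eq_zero fun j hj => ?_
    rw [zero_add]
    exact Nat.div_eq_of_lt (Finset.mem_range.1 hj)
  | succ Z ih =>
    have h1 := Finset.sum_range_succ (fun j => (Z + j) / t) t
    have h2 := Finset.sum_range_succ' (fun j => (Z + j) / t) t
    have h3 : (Z + t) / t = Z / t + 1 := Nat.add_div_right Z ht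
    have h4 : ∀ j, Z + 1 + j = Z + (j + 1) := fun j => by ring
    simp only [h4]
    simp only [add_zero] at h2
    omega

/-- The integer decomposition property of Schubert matroid polytopes: distributing the units of
`z`, read from left to right, among `t` sets in turn yields `t` bases. -/
theorem exists_bases_of_ineq {N : ℕ} (S : Finset (Fin N)) {t : ℕ} (ht : 0 < t) (z : Fin N → ℤ)
    (hz : SchubertIneq S (t : ℤ) z) :
    ∃ T : ℕ → Finset (Fin N), (∀ j < t, SchubertLE (T j) S) ∧
      ∀ i, z i = ∑ j ∈ Finset.range t, if i ∈ T j then (1 : ℤ) else 0 := by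
  obtain ⟨y, rfl⟩ : ∃ y : Fin N → ℕ, z = fun i => (y i : ℤ) :=
    ⟨fun i => (z i).toNat, funext fun i => (Int.toNat_of_nonneg (hz.nonneg i)).symm⟩
  have hyle : ∀ i, y i ≤ t := fun i => by exact_mod_cast hz.le i
  have hpre : ∀ k, t * (S.filter fun i : Fin N => (i : ℕ) < k).card ≤ prefixSum y k := fun k => by
    have h1 := hz.prefix_le k
    have h2 := map_prefixSum (Nat.castAddMonoidHom ℤ) y k
    simp only [Nat.coe_castAddMonoidHom] at h2
    rw [← h2] at h1
    exact_mod_cast h1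
  have htot : ∑ i, y i = t * S.card := by exact_mod_cast hz.total
  -- `T j` collects the positions of the units whose rank is congruent to `-j` modulo `t`.
  let g : ℕ → ℕ → ℕ := fun j k => (prefixSum y k + j) / t
  have hg : ∀ j (i : Fin N), g j (i + 1)
      = g j i + if g j i < g j (i + 1) then 1 else 0 := fun j i => by
    have h1 : g j i ≤ g j (i + 1) := Nat.div_le_div_right (by rw [prefixSum_succ y i.2]; omega)
    have h2 : g j (i + 1) ≤ g j i + 1 := by
      have : g j i + 1 = (prefixSum y i + j + t) / t := (Nat.add_div_right _ ht).symm
      rw [this]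
      refine Nat.div_le_div_right ?_
      rw [prefixSum_succ y i.2]
      have := hyle i
      simp only [Fin.eta]
      omega
    split_ifs <;> omega
  let T : ℕ → Finset (Fin N) := fun j => Finset.univ.filter fun i => g j i < g j (i + 1)
  have hT : ∀ j i, i ∈ T j ↔ g j i < g j (i + 1) := fun j i => by simp [T]
  have hcard : ∀ j < t, ∀ k ≤ N, ((T j).filter fun i : Fin N => (i : ℕ) < k).card = g j k := by
    intro j hj k
    induction k with
    | zero =>
      intro _
      have : g j 0 = 0 := by
        simp only [g, prefixSum_zero, zero_add]
        exact Nat.div_eq_of_lt hj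
      simp [this]
    | succ k ih =>
      intro hk
      have h1 := prefixSum_indicator (R := ℕ) (T j) (k + 1)
      have h2 := prefixSum_indicator (R := ℕ) (T j) k
      rw [prefixSum_succ _ hk, h2] at h1
      simp only [Nat.cast_id] at h1
      rw [← h1, ih (by omega), hg j ⟨k, hk⟩]
      simp only [hT]
  have hfull : ∀ R : Finset (Fin N), (R.filter fun i : Fin N => (i : ℕ) < N) = R := fun R =>
    Finset.filter_true_of_mem fun i _ => i.2
  refine ⟨T, fun j hj => (schubertLE_iff_prefix _ _).2 ⟨?_, fun k => ?_⟩, fun i => ?_⟩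
  · rw [← hfull (T j), hcard j hj N le_rfl]
    simp only [g]
    rw [prefixSum_of_le y le_rfl, htot, Nat.mul_add_div ht, Nat.div_eq_of_lt hj, add_zero]
  · rcases le_total k N with hk | hk
    · rw [hcard j hj k hk, Nat.le_div_iff_mul_le ht, mul_comm]
      exact (hpre k).trans (Nat.le_add_right _ _)
    · have hfull' : ∀ R : Finset (Fin N), (R.filter fun i : Fin N => (i : ℕ) < k)
          = R.filter fun i : Fin N => (i : ℕ) < N := fun R =>
        Finset.filter_congr fun i _ => ⟨fun _ => i.2, fun h => h.trans_le hk⟩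
      rw [hfull', hfull', hcard j hj N le_rfl, Nat.le_div_iff_mul_le ht, mul_comm]
      exact (hpre N).trans (Nat.le_add_right _ _)
  · have h1 : ∑ j ∈ Finset.range t, g j (i + 1) = prefixSum y (i + 1) := sum_range_add_div ht _
    have h2 : ∑ j ∈ Finset.range t, g j i = prefixSum y i := sum_range_add_div ht _
    rw [Finset.sum_congr rfl fun j _ => hg j i, Finset.sum_add_distrib, h2,
      prefixSum_succ y i.2] at h1
    simp only [hT]
    have h3 := Nat.add_left_cancel h1
    rw [Fin.eta] at h3
    rw [← h3]
    push_cast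
    rfl

/-- The lattice points of a dilated Schubert matroid polytope are the integer solutions of the
defining inequalities. -/
theorem mem_smul_matroidPolytope_iff {N : ℕ} (S : Finset (Fin N)) (t : ℕ) (z : Fin N → ℤ) :
    (fun i => (z i : ℝ)) ∈ (t : ℝ) • matroidPolytope (schubertMatroid S)
      ↔ SchubertIneq S (t : ℤ) z := by
  constructor
  · rintro ⟨y, hy, hyz⟩
    have h := matroidPolytope_ineq S hy
    have hyz' : ∀ i, (z i : ℝ) = t * y i := fun i => (congrFun hyz i).symm
    have ht : (0 : ℝ) ≤ t := Nat.cast_nonneg t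
    have hp : ∀ k, ((prefixSum z k : ℤ) : ℝ) = t * prefixSum y k := fun k => by
      have := map_prefixSum (Int.castAddHom ℝ) z k
      simp only [Int.coe_castAddHom] at this
      rw [this, ← prefixSum_mul]
      simp only [hyz']
    refine ⟨fun i => ?_, fun i => ?_, fun k => ?_, ?_⟩
    · have : (0 : ℝ) ≤ z i := by rw [hyz']; exact mul_nonneg ht (h.nonneg i)
      exact_mod_cast this
    · have : (z i : ℝ) ≤ t := by
        rw [hyz']; exact mul_le_of_le_one_right ht (h.le i)
      exact_mod_cast this
    · have h1 := mul_le_mul_of_nonneg_left (h.prefix_le k) ht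
      rw [← hp, one_mul] at h1
      exact_mod_cast h1
    · have h1 := congrArg (fun x => (t : ℝ) * x) h.total
      simp only [one_mul, Finset.mul_sum, ← hyz'] at h1
      exact_mod_cast h1
  · intro hz
    rcases Nat.eq_zero_or_pos t with rfl | ht
    · refine ⟨(S : Set (Fin N)).indicator 1, subset_convexHull ℝ _ ⟨S, ?_, rfl⟩, ?_⟩
      · exact (schubertMatroid_isBase_iff S S).2 ⟨S, rfl, rfl, fun _ => le_rfl⟩
      · ext i
        have := hz.nonneg i
        have := hz.le i
        have h0 : z i = 0 := by push_cast at *; omega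
        simp [h0]
    · obtain ⟨T, hT, hzT⟩ := exists_bases_of_ineq S ht z hz
      have ht' : (t : ℝ) ≠ 0 := by positivity
      refine ⟨∑ j ∈ Finset.range t, (1 / (t : ℝ)) • (T j : Set (Fin N)).indicator 1, ?_, ?_⟩
      · refine (convex_convexHull ℝ _).sum_mem (fun _ _ => by positivity) (by simp [ht']) ?_
        intro j hj
        exact subset_convexHull ℝ _ ⟨T j, (schubertMatroid_isBase_iff S _).2
          ⟨T j, rfl, hT j (Finset.mem_range.1 hj)⟩, rfl⟩
      · ext i
        simp only [Pi.smul_apply, Finset.sum_apply, smul_eq_mul]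
        rw [← Finset.mul_sum, ← mul_assoc, mul_one_div_cancel ht', one_mul, hzT i]
        push_cast
        refine Finset.sum_congr rfl fun j _ => ?_
        simp [Set.indicator_apply]

/-! ### Lattice points of Catalan matroid polytopes as weighted excursions -/

/-- The prefix sum over the first `q` blocks of a sequence of `n` blocks of length `m`. -/
theorem prefixSum_blocks {M : Type*} [AddCommMonoid M] {n m : ℕ} (z : Fin (n * m) → M) (q : ℕ) :
    prefixSum z (m * q) = prefixSum (fun i => ∑ j, z (finProdFinEquiv (i, j))) q := by
  unfold prefixSum
  rw [← finProdFinEquiv.sum_comp, Fintype.sum_prod_type]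
  refine Finset.sum_congr rfl fun i _ => ?_
  rcases lt_or_ge (i : ℕ) q with h | h
  · rw [if_pos h]
    refine Finset.sum_congr rfl fun j _ => if_pos ?_
    have h1 : m * ((i : ℕ) + 1) ≤ m * q := Nat.mul_le_mul_left m h
    have h2 := j.2
    rw [mul_add, mul_one] at h1
    simp only [finProdFinEquiv_apply_val]
    omega
  · rw [if_neg (not_lt.2 h)]
    refine Finset.sum_eq_zero fun j _ => if_neg ?_
    have h1 : m * q ≤ m * (i : ℕ) := Nat.mul_le_mul_left m h
    simp only [finProdFinEquiv_apply_val]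
    omega

/-- If every block of a sequence starts with `a` nonnegative and ends with `b` nonpositive entries,
then nonnegativity of the prefix sums need only be tested at the ends of blocks. -/
theorem prefixSum_nonneg_of_blocks {a b m n : ℕ} (hmdef : m = a + b) (z : Fin (n * m) → ℤ)
    (h1 : ∀ k : Fin (n * m), (k : ℕ) % m < a → 0 ≤ z k)
    (h2 : ∀ k : Fin (n * m), a ≤ (k : ℕ) % m → z k ≤ 0)
    (h : ∀ q, 0 ≤ prefixSum z (m * q)) (k : ℕ) : 0 ≤ prefixSum z k := by
  rcases le_or_gt (n * m) k with hk | hk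
  · have := h n
    rw [prefixSum_of_le z (mul_comm n m).le] at this
    rwa [prefixSum_of_le z hk]
  have hm : 0 < m := by
    rcases Nat.eq_zero_or_pos m with h0 | h0
    · rw [h0] at hk; omega
    · exact h0
  have hq : k / m + 1 ≤ n := by
    rw [Nat.succ_le_iff, Nat.div_lt_iff_lt_mul hm]; exact hk
  have hqm : m * (k / m) + m ≤ n * m := by
    have := Nat.mul_le_mul_left m hq
    rw [mul_add, mul_one, mul_comm m n] at this
    exact this
  have hmod : ∀ r < m, (m * (k / m) + r) % m = r := fun r hr => by
    rw [Nat.mul_add_mod, Nat.mod_eq_of_lt hr]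
  have hup : ∀ r ≤ a, 0 ≤ prefixSum z (m * (k / m) + r) := by
    intro r
    induction r with
    | zero => intro _; exact h _
    | succ r ih =>
      intro hr
      have hlt : m * (k / m) + r < n * m := by omega
      rw [← add_assoc, prefixSum_succ z hlt]
      have := h1 ⟨_, hlt⟩ (by simp only []; rw [hmod r (by omega)]; omega)
      have := ih (by omega)
      omega
  have hdown : ∀ d ≤ b, 0 ≤ prefixSum z (m * (k / m) + (m - d)) := by
    intro d
    induction d with
    | zero => intro _; have := h (k / m + 1); rwa [mul_add, mul_one] at this
    | succ d ih =>
      intro hd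
      have hlt : m * (k / m) + (m - (d + 1)) < n * m := by omega
      have h3 := prefixSum_succ z hlt
      rw [show m * (k / m) + (m - (d + 1)) + 1 = m * (k / m) + (m - d) by omega] at h3
      have := h2 ⟨_, hlt⟩ (by simp only []; rw [hmod _ (by omega)]; omega)
      have := ih (by omega)
      omega
  have hkm := Nat.div_add_mod k m
  have hlt := Nat.mod_lt k hm
  rcases le_total (k % m) a with hr | hr
  · have := hup _ hr
    rwa [hkm] at this
  · have := hdown (m - k % m) (by omega)
    rwa [show m - (m - k % m) = k % m by omega, hkm] at this

open Classical in
/-- The set of words of length `n` for which all partial sums of the steps `s` are nonnegative. -/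
noncomputable def nonnegWords {W : Type*} [Fintype W] (s : W → ℤ) (n : ℕ) : Finset (Fin n → W) :=
  Finset.univ.filter fun w => ∀ k, 0 ≤ prefixSum (fun i => s (w i)) k

theorem mem_nonnegWords {W : Type*} [Fintype W] {s : W → ℤ} {n : ℕ} {w : Fin n → W} :
    w ∈ nonnegWords s n ↔ ∀ k, 0 ≤ prefixSum (fun i => s (w i)) k := by
  simp [nonnegWords]

/-- The number of words of length `n` for which all partial sums of the steps `s` are nonnegative,
and the total sum is zero. -/
noncomputable def excursionCount {W : Type*} [Fintype W] (s : W → ℤ) (n : ℕ) : ℕ :=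
  ((nonnegWords s n).filter fun w => ∑ i, s (w i) = 0).card

/-- The number of words of length `n` for which the sum of the steps `s` is zero. -/
def bridgeCount {W : Type*} [Fintype W] (s : W → ℤ) (n : ℕ) : ℕ :=
  ((Finset.univ : Finset (Fin n → W)).filter fun w => ∑ i, s (w i) = 0).card

/-- The steps of the walks attached to `(a, b)`-Catalan matroids: a step comes from a word of `a + b`
letters from `{0, …, t}`, and its size is the excess of the sum of the letters over `t * b`. -/
def catalanStep (a b t : ℕ) (w : Fin (a + b) → Fin (t + 1)) : ℤ :=
  ∑ j, ((w j : ℕ) : ℤ) - t * b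

theorem schubertIneq_iff {N : ℕ} (S : Finset (Fin N)) (t : ℤ) (z : Fin N → ℤ) :
    SchubertIneq S t z ↔ (∀ i, 0 ≤ z i ∧ z i ≤ t) ∧
      (∀ k, 0 ≤ prefixSum (fun i => z i - t * if i ∈ S then 1 else 0) k) ∧
      ∑ i, (z i - t * if i ∈ S then 1 else 0) = 0 := by
  have hp : ∀ k, prefixSum (fun i => z i - t * if i ∈ S then (1 : ℤ) else 0) k
      = prefixSum z k - t * ((S.filter fun i : Fin N => (i : ℕ) < k).card : ℤ) := fun k => by
    have h := prefixSum_add z (fun i => -t * if i ∈ S then (1 : ℤ) else 0) k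
    rw [prefixSum_mul, prefixSum_indicator] at h
    simp only [neg_mul, ← sub_eq_add_neg] at h
    exact h
  have ht : ∑ i, (z i - t * if i ∈ S then (1 : ℤ) else 0) = ∑ i, z i - t * (S.card : ℤ) := by
    rw [Finset.sum_sub_distrib, ← Finset.mul_sum]
    simp
  simp only [hp, ht, sub_nonneg, sub_eq_zero]
  exact ⟨fun h => ⟨fun i => ⟨h.nonneg i, h.le i⟩, h.prefix_le, h.total⟩,
    fun h => ⟨fun i => (h.1 i).1, fun i => (h.1 i).2, h.2.1, h.2.2⟩⟩

/-- Membership in the dilated polytope of a Catalan matroid only involves the sums over blocks. -/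
theorem catalan_ineq_iff {a b n t : ℕ} (w : Fin n → Fin (a + b) → Fin (t + 1)) :
    SchubertIneq (catalanSet a b n) (t : ℤ)
        (fun k => ((w (finProdFinEquiv.symm k).1 (finProdFinEquiv.symm k).2 : ℕ) : ℤ))
      ↔ (∀ k, 0 ≤ prefixSum (fun i => catalanStep a b t (w i)) k)
        ∧ ∑ i, catalanStep a b t (w i) = 0 := by
  rw [schubertIneq_iff]
  set z : Fin (n * (a + b)) → ℤ := fun k =>
    ((w (finProdFinEquiv.symm k).1 (finProdFinEquiv.symm k).2 : ℕ) : ℤ)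
      - t * if k ∈ catalanSet a b n then 1 else 0 with hz
  have hS : ∀ k : Fin (n * (a + b)), k ∈ catalanSet a b n ↔ a ≤ (k : ℕ) % (a + b) := fun k => by
    simp [catalanSet]
  have hle : ∀ i j, ((w i j : ℕ) : ℤ) ≤ t := fun i j => by
    have := (w i j).2; omega
  have hstep : ∀ i, ∑ j, z (finProdFinEquiv (i, j)) = catalanStep a b t (w i) := fun i => by
    have hmem : ∀ j : Fin (a + b), finProdFinEquiv (i, j) ∈ catalanSet a b n ↔ a ≤ (j : ℕ) :=
      fun j => by
        rw [hS, finProdFinEquiv_apply_val]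
        simp only []
        rw [Nat.add_mul_mod_self_left, Nat.mod_eq_of_lt j.2]
    simp only [hz, hmem, Equiv.symm_apply_apply, Finset.sum_sub_distrib, ← Finset.mul_sum]
    rw [catalanStep, Fin.sum_univ_add (fun j : Fin (a + b) => if a ≤ (j : ℕ) then (1 : ℤ) else 0)]
    simp [Fin.is_lt]
  have hblk : ∀ q, prefixSum z ((a + b) * q) = prefixSum (fun i => catalanStep a b t (w i)) q :=
    fun q => by rw [prefixSum_blocks]; simp only [hstep]
  have htot : ∑ k, z k = ∑ i, catalanStep a b t (w i) := by
    rw [← prefixSum_of_le z (mul_comm n (a + b)).le, ← prefixSum_of_le _ le_rfl, ← hblk]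
  rw [htot]
  constructor
  · rintro ⟨-, h1, h2⟩
    exact ⟨fun q => by rw [← hblk]; exact h1 _, h2⟩
  · rintro ⟨h1, h2⟩
    refine ⟨fun k => ⟨by positivity, hle _ _⟩, ?_, h2⟩
    refine prefixSum_nonneg_of_blocks rfl z (fun k hk => ?_) (fun k hk => ?_) fun q => ?_
    · simp only [hz, if_neg (fun h => absurd ((hS k).1 h) (not_le.2 hk))]
      simp
    · simp only [hz, if_pos ((hS k).2 hk), mul_one]
      exact sub_nonpos.2 (hle _ _)
    · rw [hblk]; exact h1 q

/-- The Ehrhart polynomial of a Catalan matroid counts excursions. -/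
theorem ehrhart_catalan (a b n t : ℕ) :
    ehrhart (catalanMatroid a b n) t = excursionCount (catalanStep a b t) n := by
  classical
  let φ : (Fin n → Fin (a + b) → Fin (t + 1)) → Fin (n * (a + b)) → ℤ := fun w k =>
    ((w (finProdFinEquiv.symm k).1 (finProdFinEquiv.symm k).2 : ℕ) : ℤ)
  have hφ : Function.Injective φ := by
    intro w w' h
    ext i j
    have := congrFun h (finProdFinEquiv (i, j))
    simp only [φ, Equiv.symm_apply_apply] at this
    exact_mod_cast this
  have himg : {z : Fin (n * (a + b)) → ℤ |
      (fun i => (z i : ℝ)) ∈ (t : ℝ) • matroidPolytope (catalanMatroid a b n)}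
      = φ '' ((nonnegWords (catalanStep a b t) n).filter
          fun w => ∑ i, catalanStep a b t (w i) = 0 : Finset _) := by
    ext z
    rw [Set.mem_ofPred_eq, catalanMatroid, mem_smul_matroidPolytope_iff]
    simp only [Set.mem_image, Finset.mem_coe, Finset.mem_filter, mem_nonnegWords]
    constructor
    · intro h
      have hlt : ∀ k, (z k).toNat < t + 1 := fun k => by
        have := h.le k; have := h.nonneg k; omega
      have hw : φ (fun i j => ⟨(z (finProdFinEquiv (i, j))).toNat, hlt _⟩) = z := by
        ext k
        simp only [φ, Prod.mk.eta, Equiv.apply_symm_apply, Int.toNat_of_nonneg (h.nonneg k)]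
      refine ⟨fun i j => ⟨(z (finProdFinEquiv (i, j))).toNat, hlt _⟩,
        (catalan_ineq_iff _).1 ?_, hw⟩
      have h' := h
      rw [← hw] at h'
      exact h'
    · rintro ⟨w, hw, rfl⟩
      exact (catalan_ineq_iff w).2 hw
  rw [ehrhart, himg, Set.ncard_image_of_injective _ hφ, Set.ncard_coe_finset, excursionCount]

/-! ### Excursions and bridges: a factorization of the walk generating function -/

open LaurentPolynomial in
theorem coeff_zero_aeval_T {e : ℤ} (he : e ≠ 0) (q : Polynomial ℚ) :
    (Polynomial.aeval (T e : LaurentPolynomial ℚ) q).coeff 0 = q.coeff 0 := by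
  rw [Polynomial.aeval_eq_sum_range, AddMonoidAlgebra.coeff_sum, Finsupp.finsetSum_apply,
    Finset.sum_eq_single 0]
  · simp [← T_zero]
  · intro i _ hi
    have : (i : ℤ) * e ≠ 0 := mul_ne_zero (by exact_mod_cast hi) he
    simp [T_pow, this]
  · intro h
    exact absurd (Finset.mem_range.2 (Nat.succ_pos _)) h

theorem exists_mul_eq_one_of_constantCoeff {R : Type*} [CommRing R] {f : PowerSeries R}
    (hf : PowerSeries.constantCoeff f = 1) : ∃ g, f * g = 1 :=
  ⟨PowerSeries.invOfUnit f 1, PowerSeries.mul_invOfUnit f 1 (by rw [hf, Units.val_one])⟩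

theorem PowerSeries.derivative_map {R S : Type*} [CommSemiring R] [CommSemiring S] (φ : R →+* S)
    (f : PowerSeries R) : PowerSeries.derivative S (PowerSeries.map φ f)
      = PowerSeries.map φ (PowerSeries.derivative R f) := by
  ext n
  simp [PowerSeries.coeff_derivative]

open LaurentPolynomial PowerSeries in
/-- Suppose that the product of a polynomial `e n` in `u` with a Laurent polynomial `p` splits into
a polynomial `e (n + 1)` in `u` and a polynomial `d (n + 1)` in `u⁻¹` without constant term.
In terms of generating functions, `E (1 - z p) = 1 - D`. Taking logarithmic derivatives with respect
to `z` and extracting the coefficient of `u ^ 0` eliminates `D`, and expresses the logarithmic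
derivative of the constant term of `E` through the constant terms of the powers of `p`. -/
theorem derivative_constant_terms (e d : ℕ → Polynomial ℚ) (p : LaurentPolynomial ℚ)
    (he0 : e 0 = 1) (hd0 : d 0 = 0) (hd : ∀ n, (d n).coeff 0 = 0)
    (hstep : ∀ n, Polynomial.aeval (T 1 : LaurentPolynomial ℚ) (e n) * p
      = Polynomial.aeval (T 1 : LaurentPolynomial ℚ) (e (n + 1))
        + Polynomial.aeval (T (-1) : LaurentPolynomial ℚ) (d (n + 1))) :
    PowerSeries.derivative ℚ (PowerSeries.mk fun n => (e n).coeff 0)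
      = (PowerSeries.mk fun n => (e n).coeff 0)
        * PowerSeries.mk fun n => (p ^ (n + 1)).coeff 0 := by
  set φ : Polynomial ℚ →+* LaurentPolynomial ℚ :=
    (Polynomial.aeval (T 1 : LaurentPolynomial ℚ)).toRingHom with hφ
  set ψ : Polynomial ℚ →+* LaurentPolynomial ℚ :=
    (Polynomial.aeval (T (-1) : LaurentPolynomial ℚ)).toRingHom with hψ
  have hφ0 : ∀ q, (φ q).coeff 0 = q.coeff 0 := coeff_zero_aeval_T one_ne_zero
  have hψ0 : ∀ q, (ψ q).coeff 0 = q.coeff 0 := coeff_zero_aeval_T (by decide)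
  have hstep' : ∀ n, φ (e n) * p = φ (e (n + 1)) + ψ (d (n + 1)) := hstep
  set E : PowerSeries (Polynomial ℚ) := PowerSeries.mk e with hE
  set D : PowerSeries (Polynomial ℚ) := PowerSeries.mk d with hD
  set P : PowerSeries (LaurentPolynomial ℚ) := PowerSeries.C p with hP
  set G : PowerSeries (LaurentPolynomial ℚ) := PowerSeries.mk fun n => p ^ n with hG
  obtain ⟨ε, hε⟩ := exists_mul_eq_one_of_constantCoeff (f := E)
    (by rw [hE, ← coeff_zero_eq_constantCoeff_apply, coeff_mk, he0])
  obtain ⟨δ, hδ⟩ := exists_mul_eq_one_of_constantCoeff (f := 1 - D)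
    (by rw [map_sub, map_one, hD, ← coeff_zero_eq_constantCoeff_apply, coeff_mk, hd0, sub_zero])
  have hGP : G * (1 - PowerSeries.X * P) = 1 := by
    ext1 n
    rw [mul_sub, mul_one, map_sub, mul_left_comm, hG, hP]
    rcases n with _ | n
    · simp
    · rw [coeff_succ_X_mul, coeff_mul_C, coeff_mk, coeff_mk, pow_succ, sub_self, coeff_one,
        if_neg (Nat.succ_ne_zero n)]
  have hED : PowerSeries.map φ E * (1 - PowerSeries.X * P) = PowerSeries.map ψ (1 - D) := by
    ext1 n
    rw [mul_sub, mul_one, map_sub, mul_left_comm, hE, hP, map_sub, map_sub]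
    rcases n with _ | n
    · simp [hD, he0, hd0]
    · rw [coeff_succ_X_mul, coeff_mul_C, coeff_map, coeff_map, coeff_map, coeff_mk, coeff_mk,
        hstep', coeff_map, hD, coeff_mk, coeff_one, if_neg (Nat.succ_ne_zero n), map_zero]
      ring
  have hder := congrArg (PowerSeries.derivative (LaurentPolynomial ℚ)) hED
  rw [Derivation.leibniz, PowerSeries.derivative_map, PowerSeries.derivative_map, map_sub, map_sub,
    Derivation.leibniz, hP, derivative_C, derivative_X, derivative_one, derivative_one, map_sub,
    map_zero, ← hP] at hder
  simp only [smul_eq_mul, mul_zero, zero_add, mul_one, zero_sub] at hder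
  have hε' : PowerSeries.map φ E * PowerSeries.map φ ε = 1 := by rw [← map_mul, hε, map_one]
  have hδ' : PowerSeries.map ψ (1 - D) * PowerSeries.map ψ δ = 1 := by
    rw [← map_mul, hδ, map_one]
  -- Both sides are the inverse of `1 - D`.
  have hGε : G * PowerSeries.map φ ε = PowerSeries.map ψ δ := by
    linear_combination (-PowerSeries.map φ ε * G) * hδ'
      + (PowerSeries.map φ ε * PowerSeries.map ψ δ * G) * (-hED)
      + (PowerSeries.map φ ε * PowerSeries.map ψ δ * PowerSeries.map φ E) * hGP
      + PowerSeries.map ψ δ * hε'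
  have hlog : PowerSeries.map φ (PowerSeries.derivative _ E * ε)
      = P * G - PowerSeries.map ψ (PowerSeries.derivative _ D * δ) := by
    rw [map_mul, map_mul]
    linear_combination (G * PowerSeries.map φ ε) * hder
      - (PowerSeries.map φ (PowerSeries.derivative _ E) * PowerSeries.map φ ε) * hGP
      + (P * G) * hε' - PowerSeries.map ψ (PowerSeries.derivative _ D) * hGε
  set c : Polynomial ℚ →+* ℚ := Polynomial.constantCoeff with hc
  have hcD : PowerSeries.map c D = 0 := by
    ext n
    rw [coeff_map, hD, coeff_mk, hc, Polynomial.constantCoeff_apply, hd, map_zero]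
  have hcE : PowerSeries.map c E = PowerSeries.mk fun n => (e n).coeff 0 := by
    ext n
    rw [coeff_map, hE, coeff_mk, coeff_mk, hc, Polynomial.constantCoeff_apply]
  have hconst : PowerSeries.map c (PowerSeries.derivative _ E * ε)
      = PowerSeries.mk fun n => (p ^ (n + 1)).coeff 0 := by
    have hDδ : PowerSeries.map c (PowerSeries.derivative _ D * δ) = 0 := by
      rw [map_mul, ← PowerSeries.derivative_map, hcD, map_zero, zero_mul]
    ext n
    have h1 := congrArg (fun x : LaurentPolynomial ℚ => x.coeff 0)
      (congrArg (PowerSeries.coeff n) hlog)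
    have h2 := congrArg (PowerSeries.coeff n) hDδ
    simp only [map_sub, coeff_map, AddMonoidAlgebra.coeff_sub, Finsupp.sub_apply, hφ0, hψ0] at h1
    rw [coeff_map, hc, Polynomial.constantCoeff_apply, map_zero] at h2
    rw [coeff_map, hc, Polynomial.constantCoeff_apply, h1, h2, sub_zero, hP, hG, coeff_C_mul,
      coeff_mk, coeff_mk, pow_succ']
  have hcε : PowerSeries.map c E * PowerSeries.map c ε = 1 := by rw [← map_mul, hε, map_one]
  rw [map_mul, ← PowerSeries.derivative_map, hcE] at hconst
  rw [hcE] at hcε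
  rw [← hconst]
  linear_combination (-PowerSeries.derivative ℚ (PowerSeries.mk fun n => (e n).coeff 0)) * hcε

section Walks

variable {W : Type*} (s : W → ℤ)

theorem prefixSum_snoc {n : ℕ} (w : Fin n → W) (x : W) {k : ℕ} (hk : k ≤ n) :
    prefixSum (fun i => s ((Fin.snoc w x : Fin (n + 1) → W) i)) k
      = prefixSum (fun i => s (w i)) k := by
  unfold prefixSum
  rw [Fin.sum_univ_castSucc]
  simp [not_lt.2 hk]

theorem sum_snoc {n : ℕ} (w : Fin n → W) (x : W) :
    ∑ i, s ((Fin.snoc w x : Fin (n + 1) → W) i) = ∑ i, s (w i) + s x := by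
  rw [Fin.sum_univ_castSucc]
  simp

variable [Fintype W]

theorem snoc_mem_nonnegWords {n : ℕ} (w : Fin n → W) (x : W) :
    (Fin.snoc w x : Fin (n + 1) → W) ∈ nonnegWords s (n + 1)
      ↔ w ∈ nonnegWords s n ∧ 0 ≤ ∑ i, s (w i) + s x := by
  simp only [mem_nonnegWords]
  constructor
  · intro h
    refine ⟨fun k => ?_, ?_⟩
    · rcases le_total k n with hk | hk
      · rw [← prefixSum_snoc s w x hk]; exact h k
      · have := h n
        rwa [prefixSum_snoc s w x le_rfl, prefixSum_of_le _ le_rfl, ← prefixSum_of_le _ hk] at this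
    · have := h (n + 1)
      rwa [prefixSum_of_le _ le_rfl, sum_snoc] at this
  · rintro ⟨h, h'⟩ k
    rcases le_or_gt k n with hk | hk
    · rw [prefixSum_snoc s w x hk]; exact h k
    · rw [prefixSum_of_le _ hk, sum_snoc]; exact h'

/-- The generating polynomial of the final heights of the words in `nonnegWords`. -/
noncomputable def nonnegPoly (n : ℕ) : Polynomial ℚ :=
  ∑ w ∈ nonnegWords s n, Polynomial.X ^ (∑ i, s (w i)).toNat

/-- The generating polynomial of the final depths of the words of length `n` whose partial sums
become negative exactly at the last step. -/
noncomputable def firstExitPoly : ℕ → Polynomial ℚ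
  | 0 => 0
  | n + 1 => ∑ w ∈ nonnegWords s n, ∑ x,
      if 0 ≤ ∑ i, s (w i) + s x then 0 else Polynomial.X ^ (-(∑ i, s (w i) + s x)).toNat

theorem nonneg_sum_of_mem {n : ℕ} {w : Fin n → W} (hw : w ∈ nonnegWords s n) :
    0 ≤ ∑ i, s (w i) := by
  have := mem_nonnegWords.1 hw n
  rwa [prefixSum_of_le _ le_rfl] at this

theorem nonnegPoly_succ (n : ℕ) :
    nonnegPoly s (n + 1) = ∑ w ∈ nonnegWords s n, ∑ x,
      if 0 ≤ ∑ i, s (w i) + s x then Polynomial.X ^ (∑ i, s (w i) + s x).toNat else 0 := by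
  classical
  have h : ∀ (m : ℕ) (f : (Fin m → W) → Polynomial ℚ),
      ∑ w ∈ nonnegWords s m, f w = ∑ w, if w ∈ nonnegWords s m then f w else 0 := fun m f => by
    rw [Finset.sum_ite_mem, Finset.univ_inter]
  rw [nonnegPoly, h, ← (Fin.snocEquiv fun _ => W).sum_comp, Fintype.sum_prod_type_right, h]
  refine Finset.sum_congr rfl fun w _ => ?_
  have hs : ∀ x, (Fin.snocEquiv fun _ => W) (x, w) = (Fin.snoc w x : Fin (n + 1) → W) :=
    fun _ => rfl
  simp only [hs, snoc_mem_nonnegWords, sum_snoc]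
  by_cases hw : w ∈ nonnegWords s n <;> simp [hw]

open LaurentPolynomial in
theorem nonnegPoly_step (n : ℕ) :
    Polynomial.aeval (T 1 : LaurentPolynomial ℚ) (nonnegPoly s n) * (∑ x, T (s x))
      = Polynomial.aeval (T 1 : LaurentPolynomial ℚ) (nonnegPoly s (n + 1))
        + Polynomial.aeval (T (-1) : LaurentPolynomial ℚ) (firstExitPoly s (n + 1)) := by
  rw [nonnegPoly_succ, nonnegPoly, firstExitPoly, map_sum, map_sum, map_sum, Finset.sum_mul,
    ← Finset.sum_add_distrib]
  refine Finset.sum_congr rfl fun w hw => ?_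
  rw [map_sum, map_sum, Finset.mul_sum, ← Finset.sum_add_distrib]
  refine Finset.sum_congr rfl fun x _ => ?_
  rw [map_pow, Polynomial.aeval_X, T_pow, mul_one, Int.toNat_of_nonneg (nonneg_sum_of_mem s hw),
    ← T_add]
  split_ifs with h
  · rw [map_zero, add_zero, map_pow, Polynomial.aeval_X, T_pow, mul_one, Int.toNat_of_nonneg h]
  · rw [map_zero, zero_add, map_pow, Polynomial.aeval_X, T_pow, Int.toNat_of_nonneg (by omega)]
    congr 1
    ring

theorem coeff_zero_nonnegPoly (n : ℕ) : (nonnegPoly s n).coeff 0 = excursionCount s n := by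
  rw [nonnegPoly, Polynomial.finsetSum_coeff, excursionCount, Finset.card_filter, Nat.cast_sum]
  refine Finset.sum_congr rfl fun w hw => ?_
  have := nonneg_sum_of_mem s hw
  rw [Polynomial.coeff_X_pow, Nat.cast_ite, Nat.cast_one, Nat.cast_zero]
  exact if_congr (by omega) rfl rfl

theorem coeff_zero_firstExitPoly (n : ℕ) : (firstExitPoly s n).coeff 0 = 0 := by
  rcases n with _ | n
  · rfl
  · rw [firstExitPoly, Polynomial.finsetSum_coeff]
    refine Finset.sum_eq_zero fun w _ => ?_
    rw [Polynomial.finsetSum_coeff]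
    refine Finset.sum_eq_zero fun x _ => ?_
    split_ifs with h
    · rfl
    · rw [Polynomial.coeff_X_pow, if_neg (by omega)]

open LaurentPolynomial in
theorem coeff_zero_pow_stepPoly (n : ℕ) :
    (((∑ x, T (s x) : LaurentPolynomial ℚ)) ^ n).coeff 0 = bridgeCount s n := by
  have hT : ∀ (w : Fin n → W) (S : Finset (Fin n)),
      (∏ i ∈ S, T (s (w i)) : LaurentPolynomial ℚ) = T (∑ i ∈ S, s (w i)) := fun w S => by
    classical
    induction S using Finset.induction_on with
    | empty => simp
    | insert i S hi ih => rw [Finset.prod_insert hi, Finset.sum_insert hi, ih, T_add]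
  rw [Fintype.sum_pow, AddMonoidAlgebra.coeff_sum, Finsupp.finsetSum_apply, bridgeCount,
    Finset.card_filter, Nat.cast_sum]
  refine Finset.sum_congr rfl fun w _ => ?_
  rw [hT, T_apply, Nat.cast_ite, Nat.cast_one, Nat.cast_zero]

theorem excursionCount_zero : excursionCount s 0 = 1 := by
  classical
  simp [excursionCount, nonnegWords, prefixSum]

/-- The logarithmic derivative of the generating function of excursions is the generating function
of bridges. -/
theorem derivative_excursionCount :
    PowerSeries.derivative ℚ (PowerSeries.mk fun n => (excursionCount s n : ℚ))
      = (PowerSeries.mk fun n => (excursionCount s n : ℚ))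
        * PowerSeries.mk fun n => (bridgeCount s (n + 1) : ℚ) := by
  have h := derivative_constant_terms (nonnegPoly s) (firstExitPoly s) _
    (by classical simp [nonnegPoly, nonnegWords, prefixSum]) rfl (coeff_zero_firstExitPoly s)
    (nonnegPoly_step s)
  simpa only [coeff_zero_nonnegPoly, coeff_zero_pow_stepPoly] using h

end Walks

/-! ### The number of bridges -/

section Letters

open PowerSeries

theorem sum_fin_X_pow (t : ℕ) :
    (∑ i : Fin (t + 1), (X : PowerSeries ℤ) ^ (i : ℕ)) = mk 1 * (1 - X ^ (t + 1)) := by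
  rw [Fin.sum_univ_eq_sum_range (fun i => (X : PowerSeries ℤ) ^ i), ← geom_sum_mul_neg,
    mul_comm, mul_assoc, mul_comm (1 - X), mk_one_mul_one_sub_eq_one, mul_one]

theorem intBinom_natCast (n k : ℕ) : intBinom (n : ℤ) (k : ℤ) = (n.choose k : ℤ) := by
  unfold intBinom
  split_ifs with h
  · simp
  · rw [Nat.choose_eq_zero_of_lt (by omega), Nat.cast_zero]

/-- The number of words of `M + 1` letters from `{0, …, t}` with sum `c`, as the coefficient of `X ^ c`
in `(1 - X ^ (t + 1)) ^ (M + 1) / (1 - X) ^ (M + 1)`. -/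
theorem coeff_sum_fin_X_pow_pow (t M c : ℕ) :
    coeff c ((∑ i : Fin (t + 1), (X : PowerSeries ℤ) ^ (i : ℕ)) ^ (M + 1))
      = ∑ j ∈ Finset.range (M + 2), (-1) ^ j * ((M + 1).choose j : ℤ)
          * intBinom ((c : ℤ) - (t + 1) * j + M) M := by
  rw [sum_fin_X_pow, mul_pow, mk_one_pow_eq_mk_choose_add, sub_eq_neg_add, add_pow, Finset.mul_sum,
    map_sum]
  refine Finset.sum_congr rfl fun j _ => ?_
  rw [one_pow, mul_one, neg_pow, ← pow_mul]
  have h1 : ((-1 : PowerSeries ℤ) ^ j * X ^ ((t + 1) * j) * ((M + 1).choose j : PowerSeries ℤ))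
      = X ^ ((t + 1) * j) * PowerSeries.C ((-1) ^ j * ((M + 1).choose j : ℤ)) := by
    simp only [map_mul, map_pow, map_neg, map_one, map_natCast]
    ring
  rw [h1, mul_comm, mul_assoc, coeff_X_pow_mul']
  split_ifs with h
  · rw [coeff_C_mul, coeff_mk]
    congr 1
    rw [← intBinom_natCast]
    congr 1
    push_cast [Nat.cast_sub h]
    ring
  · have h2 : (c : ℤ) < (t + 1) * j := by
      have := not_le.1 h
      exact_mod_cast this
    -- The upper entry is less than `M`, so `intBinom` vanishes by convention.
    rw [intBinom, if_neg (by omega), mul_zero]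

/-- The number of bridges is given by the alternating sum `schubertF`. -/
theorem bridgeCount_catalanStep {a b n : ℕ} (ha : 1 ≤ a) (hn : 1 ≤ n) (t : ℕ) :
    (bridgeCount (catalanStep a b t) n : ℤ) = schubertF (n * a) (n * b) 0 t := by
  have hcount : coeff (n * (t * b))
      ((∑ i : Fin (t + 1), (X : PowerSeries ℤ) ^ (i : ℕ)) ^ ((a + b) * n))
        = (bridgeCount (catalanStep a b t) n : ℤ) := by
    rw [pow_mul, Fintype.sum_pow, Fintype.sum_pow, map_sum, bridgeCount, Finset.card_filter,
      Nat.cast_sum]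
    refine Finset.sum_congr rfl fun w _ => ?_
    simp only [Finset.prod_pow_eq_pow_sum]
    rw [coeff_X_pow, Nat.cast_ite, Nat.cast_one, Nat.cast_zero]
    refine if_congr ?_ rfl rfl
    simp only [catalanStep, Finset.sum_sub_distrib, Finset.sum_const, Finset.card_univ,
      Fintype.card_fin, nsmul_eq_mul, sub_eq_zero]
    rw [eq_comm]
    norm_cast
  obtain ⟨M, hM⟩ : ∃ M, (a + b) * n = M + 1 :=
    ⟨(a + b) * n - 1, by have : 1 ≤ (a + b) * n := Nat.mul_pos (by omega) hn; omega⟩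
  have hM' : n * a + n * b = M + 1 := by rw [← hM]; ring
  have hMz : ((n * a : ℕ) : ℤ) + ((n * b : ℕ) : ℤ) = ((M + 1 : ℕ) : ℤ) := by exact_mod_cast hM'
  rw [← hcount, hM, coeff_sum_fin_X_pow_pow, schubertF, hM']
  refine Finset.sum_congr rfl fun j _ => ?_
  rw [hMz, intBinom_natCast]
  congr 2
  · push_cast at hMz ⊢
    linear_combination -hMz
  · push_cast
    ring

end Letters

/-! ### Logarithms of power series as sums over compositions -/

theorem Composition.prod_blocksFun {M : Type*} [CommMonoid M] {n : ℕ} (σ : Composition n)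
    (g : ℕ → M) : ∏ j : Fin σ.length, g (σ.blocksFun j) = (σ.blocks.map g).prod := by
  rw [← σ.ofFn_blocksFun, List.map_ofFn, List.prod_ofFn]
  rfl

/-- The coefficients of the powers of a power series without constant term, as sums over
compositions. -/
theorem PowerSeries.coeff_pow_eq_sum_composition {R : Type*} [CommSemiring R] {G : PowerSeries R}
    (hG : PowerSeries.constantCoeff G = 0) (n s : ℕ) :
    PowerSeries.coeff n (G ^ s) = ∑ σ : Composition n with σ.length = s,
      (σ.blocks.map fun m => PowerSeries.coeff m G).prod := by
  have h1 : G ^ s = ∏ _i : Fin s, G := by simp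
  rw [h1, PowerSeries.coeff_prod]
  symm
  refine Finset.sum_of_injOn
    (fun σ => Finsupp.equivFunOnFinite.symm fun i : Fin s => σ.blocks.getD i 0) ?_ ?_ ?_ ?_
  · intro σ hσ τ hτ h
    have hσ' : σ.blocks.length = s := (Finset.mem_filter.1 hσ).2
    have hτ' : τ.blocks.length = s := (Finset.mem_filter.1 hτ).2
    have h' := Finsupp.equivFunOnFinite.symm.injective h
    refine Composition.ext (List.ext_getElem (hσ'.trans hτ'.symm) fun i hi hi' => ?_)
    have := congrFun h' ⟨i, hσ' ▸ hi⟩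
    simpa [List.getD_eq_getElem, hi, hi'] using this
  · intro σ hσ
    have hσ' : σ.blocks.length = s := (Finset.mem_filter.1 hσ).2
    subst hσ'
    rw [Finset.mem_coe, Finset.mem_finsuppAntidiag]
    refine ⟨?_, Finset.subset_univ _⟩
    simp only [Finsupp.equivFunOnFinite_symm_apply_apply]
    simp
  · intro l hl hl'
    by_contra hne
    have hpos : ∀ i, 0 < l i := fun i => by
      by_contra h0
      refine hne (Finset.prod_eq_zero (Finset.mem_univ i) ?_)
      rw [Nat.eq_zero_of_not_pos h0, PowerSeries.coeff_zero_eq_constantCoeff_apply, hG]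
    refine hl' ⟨⟨List.ofFn l, ?_, ?_⟩, ?_, ?_⟩
    · intro i hi
      obtain ⟨j, rfl⟩ := (List.mem_ofFn' _ _).1 hi
      exact hpos j
    · rw [List.sum_ofFn]; exact (Finset.mem_finsuppAntidiag.1 hl).1
    · simp [Composition.length]
    · ext i
      simp
  · intro σ hσ
    have hσ' : σ.blocks.length = s := (Finset.mem_filter.1 hσ).2
    subst hσ'
    rw [← Composition.prod_blocksFun]
    refine Finset.prod_congr rfl fun i _ => ?_
    simp [Composition.blocksFun]

/-- If `c` are the coefficients of the logarithmic derivative of the generating function of `h`,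
then expanding `log (1 + (H - 1))` shows that `c n / n` is an alternating sum over compositions. -/
theorem logDeriv_coeff_eq_sum_composition (h c : ℕ → ℚ) (h0 : h 0 = 1)
    (hc : PowerSeries.derivative ℚ (PowerSeries.mk h)
      = PowerSeries.mk h * PowerSeries.mk fun n => c (n + 1)) {n : ℕ} (hn : n ≠ 0) :
    c n / n = ∑ σ : Composition n,
      (-1) ^ (σ.length + 1) / (σ.length : ℚ) * (σ.blocks.map h).prod := by
  set G : PowerSeries ℚ := PowerSeries.mk h - 1 with hGdef
  have hG0 : PowerSeries.constantCoeff G = 0 := by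
    rw [hGdef, map_sub, map_one, ← PowerSeries.coeff_zero_eq_constantCoeff_apply,
      PowerSeries.coeff_mk, h0, sub_self]
  have hG : PowerSeries.HasSubst G := PowerSeries.HasSubst.of_constantCoeff_zero' hG0
  set L : PowerSeries ℚ := (PowerSeries.log ℚ).subst G with hL
  have hgeom : (PowerSeries.derivative ℚ (PowerSeries.log ℚ)) * (1 + PowerSeries.X) = 1 := by
    rw [PowerSeries.deriv_log]
    ext m
    rcases m with _ | m
    · simp
    · rw [mul_add, mul_one, map_add, PowerSeries.coeff_succ_mul_X]
      simp [PowerSeries.coeff_one, pow_succ]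
  have hL' : PowerSeries.derivative ℚ L = PowerSeries.mk fun n => c (n + 1) := by
    have h1 := congrArg (PowerSeries.substAlgHom hG) hgeom
    rw [map_mul, map_add, map_one, PowerSeries.substAlgHom_X, PowerSeries.coe_substAlgHom] at h1
    have h2 : 1 + G = PowerSeries.mk h := by rw [hGdef]; ring
    have h3 : PowerSeries.derivative ℚ G = PowerSeries.derivative ℚ (PowerSeries.mk h) := by
      rw [hGdef, map_sub, PowerSeries.derivative_one, sub_zero]
    rw [h2] at h1
    rw [hL, PowerSeries.derivative_subst hG, h3, hc, ← mul_assoc, h1, one_mul]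
  have hcoeff : PowerSeries.coeff n L = c n / n := by
    obtain ⟨m, rfl⟩ := Nat.exists_eq_succ_of_ne_zero hn
    have h1 := congrArg (PowerSeries.coeff m) hL'
    rw [PowerSeries.coeff_derivative, PowerSeries.coeff_mk] at h1
    rw [eq_div_iff (by positivity), ← h1]
    push_cast
    rfl
  have hpow := PowerSeries.coeff_pow_eq_sum_composition hG0 n
  have hprod : ∀ σ : Composition n, (σ.blocks.map fun m => PowerSeries.coeff m G).prod
      = (σ.blocks.map h).prod := fun σ => by
    congr 1
    refine List.map_congr_left fun m hm => ?_
    have := σ.one_le_blocks hm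
    rw [hGdef, map_sub, PowerSeries.coeff_mk, PowerSeries.coeff_one, if_neg (by omega), sub_zero]
  simp only [hprod] at hpow
  rw [← hcoeff, hL, PowerSeries.coeff_subst' hG,
    finsum_eq_sum_of_support_subset (s := Finset.range (n + 1))]
  · rw [← Finset.sum_fiberwise_of_maps_to (s := Finset.univ) (t := Finset.range (n + 1))
      (g := Composition.length) fun σ _ => Finset.mem_range.2 (Nat.lt_succ_of_le σ.length_le)]
    refine Finset.sum_congr rfl fun d _ => ?_
    rw [hpow, smul_eq_mul, Finset.mul_sum]
    refine Finset.sum_congr rfl fun σ hσ => ?_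
    have hd : σ.length = d := (Finset.mem_filter.1 hσ).2
    have hpos : σ.length ≠ 0 := (σ.length_pos_iff.2 (Nat.pos_of_ne_zero hn)).ne'
    rw [PowerSeries.coeff_log, ← hd, if_neg hpos]
    rfl
  · intro d hd
    rw [Finset.mem_coe, Finset.mem_range]
    by_contra hlt
    refine hd ?_
    beta_reduce
    rw [hpow, Finset.sum_eq_zero, smul_zero]
    intro σ hσ
    have hd : σ.length = d := (Finset.mem_filter.1 hσ).2
    have := σ.length_le
    omega

/-! ### Cyclic classes of compositions -/

/-- Summing a function that is invariant under cyclic shifts over all admissible compositions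
amounts to a sum over a transversal, weighted by the cardinalities of the classes. -/
theorem sum_admissible_eq_sum_transversal {n : ℕ} {Γ : Finset (Composition n)}
    (hΓ : IsCyclicTransversal Γ) (f : Composition n → ℚ)
    (hf : ∀ σ τ : Composition n, CyclicEquiv σ τ → f σ = f τ) (A : Finset (Composition n))
    (hA : ∀ σ, σ ∈ A ↔ IsAdmissible σ) :
    ∑ σ ∈ A, f σ = ∑ τ ∈ Γ, (cyclicClassCard τ : ℚ) * f τ := by
  classical
  have hAU : A = Γ.biUnion fun τ => Finset.univ.filter fun σ => CyclicEquiv τ σ := by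
    ext σ
    simp only [hA, Finset.mem_biUnion, Finset.mem_filter, Finset.mem_univ, true_and]
    constructor
    · intro hσ
      obtain ⟨τ, hτ, h⟩ := hΓ.exists_equiv σ hσ
      exact ⟨τ, hτ, List.IsRotated.symm h⟩
    · rintro ⟨τ, hτ, h⟩
      have hp := List.IsRotated.perm h
      obtain ⟨h1, h2⟩ := hΓ.admissible τ hτ
      exact ⟨by rw [Composition.length, ← hp.length_eq]; exact h1,
        fun p hp' => h2 p (hp.mem_iff.2 hp')⟩
  rw [hAU, Finset.sum_biUnion]
  · refine Finset.sum_congr rfl fun τ _ => ?_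
    rw [Finset.sum_congr rfl fun σ hσ => (hf τ σ (Finset.mem_filter.1 hσ).2).symm,
      Finset.sum_const, nsmul_eq_mul, cyclicClassCard, ← Set.ncard_coe_finset]
    congr 3
    ext σ
    simp
  · intro τ hτ τ' hτ' hne
    refine Finset.disjoint_left.2 fun σ h1 h2 => hne (hΓ.eq_of_equiv τ hτ τ' hτ' ?_)
    exact List.IsRotated.trans (Finset.mem_filter.1 h1).2
      (List.IsRotated.symm (Finset.mem_filter.1 h2).2)

/-! ### The Ehrhart polynomials of Catalan matroids -/

/-- The generating function of `barEhrhart` is that of the Ehrhart polynomials times `1 - F z`;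
this changes the coefficients of the logarithmic derivative by powers of `F`. -/
theorem derivative_one_sub_mul (A B : PowerSeries ℚ) (F : ℚ)
    (h : PowerSeries.derivative ℚ A = A * B) :
    PowerSeries.derivative ℚ ((1 - PowerSeries.C F * PowerSeries.X) * A)
      = ((1 - PowerSeries.C F * PowerSeries.X) * A)
        * (B - PowerSeries.mk fun n => F ^ (n + 1)) := by
  have hgeom : (PowerSeries.mk fun n => F ^ (n + 1)) * (1 - PowerSeries.C F * PowerSeries.X)
      = PowerSeries.C F := by
    ext m
    rw [mul_sub, mul_one, map_sub, mul_left_comm, PowerSeries.coeff_C_mul]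
    rcases m with _ | m
    · simp
    · rw [PowerSeries.coeff_succ_mul_X, PowerSeries.coeff_mk, PowerSeries.coeff_mk,
        PowerSeries.coeff_C, if_neg (Nat.succ_ne_zero m)]
      ring
  rw [Derivation.leibniz, h, map_sub, PowerSeries.derivative_one, Derivation.leibniz,
    PowerSeries.derivative_C, PowerSeries.derivative_X]
  simp only [smul_eq_mul]
  linear_combination A * hgeom

theorem ehrhart_catalan_one {a b : ℕ} (ha : 1 ≤ a) (t : ℕ) :
    (ehrhart (catalanMatroid a b 1) t : ℤ) = schubertF a b 0 t := by
  have h := congrArg (PowerSeries.coeff 0) (derivative_excursionCount (catalanStep a b t))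
  have hB := bridgeCount_catalanStep (b := b) ha le_rfl t
  rw [one_mul, one_mul] at hB
  rw [PowerSeries.coeff_derivative, PowerSeries.coeff_mk, PowerSeries.coeff_mul,
    Finset.Nat.antidiagonal_zero, Finset.sum_singleton, PowerSeries.coeff_mk,
    PowerSeries.coeff_mk, excursionCount_zero, zero_add, Nat.cast_zero, zero_add, mul_one,
    Nat.cast_one, one_mul] at h
  rw [← hB, ehrhart_catalan]
  exact_mod_cast h

theorem theorem1p5 (a b n : ℕ) (ha : 1 ≤ a) (hb : 1 ≤ b) (hn : 2 ≤ n)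
    (Γ : Finset (Composition n)) (hΓ : IsCyclicTransversal Γ) (t : ℕ) :
    (ehrhart (catalanMatroid a b n) t : ℚ)
        = 1 / (n : ℚ) * (schubertF (n * a) (n * b) 0 t : ℚ)
          - 1 / (n : ℚ) * (schubertF a b 0 t : ℚ) ^ n
          + (schubertF a b 0 t : ℚ) * (ehrhart (catalanMatroid a b (n - 1)) t : ℚ)
          + ∑ σ ∈ Γ, (-1 : ℚ) ^ σ.length * ((cyclicClassCard σ : ℚ) / (σ.length : ℚ))
              * (barEhrhartComp a b σ t : ℚ)
      ∧ (ehrhart (catalanMatroid a b 1) t : ℤ) = schubertF a b 0 t := by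
  classical
  refine ⟨?_, ehrhart_catalan_one ha t⟩
  set s := catalanStep a b t with hs
  set F : ℚ := (schubertF a b 0 t : ℚ) with hF
  -- `barEhrhart a b 0 t` involves the truncated subtraction `0 - 1`, so the constant term is set to `1`.
  set h : ℕ → ℚ := fun m => if m = 0 then 1 else (barEhrhart a b m t : ℚ) with hh
  have hgen : PowerSeries.mk h = (1 - PowerSeries.C F * PowerSeries.X)
      * PowerSeries.mk fun m => (excursionCount s m : ℚ) := by
    ext m
    rw [sub_mul, one_mul, map_sub, mul_assoc, PowerSeries.coeff_C_mul]
    rcases m with _ | m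
    · simp [hh, excursionCount_zero]
    · rw [PowerSeries.coeff_succ_X_mul]
      simp [hh, barEhrhart, ehrhart_catalan, hF, hs]
  have hder : PowerSeries.derivative ℚ (PowerSeries.mk h) = PowerSeries.mk h
      * PowerSeries.mk fun m => ((bridgeCount s (m + 1) : ℚ) - F ^ (m + 1)) := by
    rw [hgen, derivative_one_sub_mul _ _ F (derivative_excursionCount s)]
    congr 1
  have hlog := logDeriv_coeff_eq_sum_composition h (fun m => (bridgeCount s m : ℚ) - F ^ m)
    (by simp [hh]) hder (n := n) (by omega)
  have hB : (bridgeCount s n : ℚ) = (schubertF (n * a) (n * b) 0 t : ℚ) := by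
    rw [← bridgeCount_catalanStep ha (by omega) t, Int.cast_natCast]
  have h1 : h 1 = 0 := by
    have h0 : ehrhart (catalanMatroid a b 0) t = 1 := by
      rw [ehrhart_catalan, excursionCount_zero]
    have h1' : barEhrhart a b 1 t = 0 := by
      rw [barEhrhart, ehrhart_catalan_one ha t, Nat.sub_self, h0, Nat.cast_one, mul_one, sub_self]
    simp [hh, h1']
  have hhn : h n = (ehrhart (catalanMatroid a b n) t : ℚ)
      - F * (ehrhart (catalanMatroid a b (n - 1)) t : ℚ) := by
    simp [hh, barEhrhart, hF, show n ≠ 0 by omega]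
  set f : Composition n → ℚ := fun σ =>
    (-1) ^ (σ.length + 1) / (σ.length : ℚ) * (σ.blocks.map h).prod with hf
  have hsplit : ∑ σ, f σ = h n + ∑ σ : Composition n with IsAdmissible σ, f σ := by
    have hpos : 0 < n := by omega
    rw [← Finset.add_sum_erase _ _ (Finset.mem_univ (Composition.single n hpos))]
    congr 1
    · simp [hf, Composition.single_length, Composition.single_blocks]
    · symm
      refine Finset.sum_subset (fun σ hσ => ?_) fun σ hσ hσ' => ?_
      · refine Finset.mem_erase.2 ⟨?_, Finset.mem_univ _⟩
        rintro rfl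
        have := (Finset.mem_filter.1 hσ).2.1
        rw [Composition.single_length] at this
        omega
      · have hlen : 1 < σ.length := by
          have := mt (Composition.eq_single_iff_length hpos).2 (Finset.mem_erase.1 hσ).1
          have := σ.length_pos_iff.2 hpos
          omega
        have hmem : 1 ∈ σ.blocks := by
          by_contra hmem
          refine hσ' (Finset.mem_filter.2 ⟨Finset.mem_univ _, hlen, fun p hp => ?_⟩)
          have := σ.one_le_blocks hp
          have : p ≠ 1 := fun h => hmem (h ▸ hp)
          omega
        simp only [hf]
        rw [List.prod_eq_zero (List.mem_map.2 ⟨1, hmem, h1⟩), mul_zero]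
  have hgroup := sum_admissible_eq_sum_transversal hΓ f (fun σ τ hστ => by
    have hp := List.IsRotated.perm hστ
    have hl : σ.length = τ.length := hp.length_eq
    simp only [hf, hl, (hp.map h).prod_eq]) (Finset.univ.filter IsAdmissible) (by simp)
  have hΓsum : ∑ τ ∈ Γ, (cyclicClassCard τ : ℚ) * f τ
      = -∑ σ ∈ Γ, (-1 : ℚ) ^ σ.length * ((cyclicClassCard σ : ℚ) / (σ.length : ℚ))
              * (barEhrhartComp a b σ t : ℚ) := by
    rw [← Finset.sum_neg_distrib]
    refine Finset.sum_congr rfl fun σ _ => ?_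
    have hbar : (barEhrhartComp a b σ t : ℚ) = (σ.blocks.map h).prod := by
      rw [barEhrhartComp, ← Composition.prod_blocksFun, Int.cast_prod]
      refine Finset.prod_congr rfl fun j _ => ?_
      have := σ.one_le_blocksFun j
      simp [hh, show σ.blocksFun j ≠ 0 by omega]
    simp only [hf, hbar]
    ring
  rw [hsplit, hgroup, hΓsum, hhn, hB] at hlog
  linear_combination -hlog
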